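/- Let $q$ be a prime power and let $0\le r\le c\le n$ be integers. Let $M=M(n,q;r,c)$ be the real $0$-$1$ matrix whose rows are indexed by the $r$-dimensional subspaces $R$ of $GF(q)^n$, whose columns are indexed by the $c$-dimensional subspaces $C$ of $GF(q)^n$, and whose $(R,C)$-entry is $1$ if $R\subseteq C$ and $0$ otherwise. Put $[k]_q=\frac{q^k-1}{q-1}$ and $[k]_q!=[1]_q[2]_q\cdots[k]_q$ for integers $k\ge 0$. For integers $a$ and $m\ge 0$ let $\binom{a}{0}_q=1$ for every $a$ (in particular $\binom{-1}{0}_q=1$), $\binom{a}{m}_q=\frac{[a]_q!}{[m]_q!\,[a-m]_q!}$ if $0<m\le a$, and $\binom{a}{m}_q=0$ if $m>0$ and $m>a$. Let $M^*$ be the real matrix with rows indexed by the $c$-dimensional subspaces $C$ and columns indexed by the $r$-dimensional subspaces $R$ of $GF(q)^n$, with $$M^*_{C,R}=(-1)^{r-i}\,\frac{\binom{c-i-1}{r-i}_q}{\binom{N-r}{c-r}_q\binom{N-c}{r-i}_q}\cdot\frac{1}{q^{(c-r)(r-i)+\binom{r-i}{2}}},\qquad N=\max\{n,r+c\},\quad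 i=\dim(R\cap C).$$ Then $M^*$ is the Moore–Penrose inverse of $M$, that is, $G=M^*$ is the unique real matrix $G$ satisfying $MGM=M$, $GMG=G$, $(MG)^T=MG$ and $(GM)^T=GM$. -/

import Mathlib

/-- `IsMoorePenroseInverse A G`: the matrix `G` satisfies the four Penrose equations for `A`. -/
structure IsMoorePenroseInverse {K m n : Type*} [CommRing K] [Fintype m] [Fintype n]
    (A : Matrix m n K) (G : Matrix n m K) : Prop where
  mul_mul_left : A * G * A = A
  mul_mul_right : G * A * G = G
  transpose_left : (A * G).transpose = A * G
  transpose_right : (G * A).transpose = G * A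

/-- The `k`-dimensional linear subspaces of `F ^ n`. -/
abbrev DimSubspace (F : Type*) [Field F] (n k : ℕ) : Type _ :=
  {W : Submodule F (Fin n → F) // Module.finrank F W = k}

noncomputable instance DimSubspace.instFintype (F : Type*) [Field F] [Finite F] (n k : ℕ) :
    Fintype (DimSubspace F n k) :=
  Fintype.ofFinite _

/-- The `q`-integer `[k]_q = (q ^ k - 1) / (q - 1)`. -/
noncomputable def qInteger (q k : ℕ) : ℝ :=
  ((q : ℝ) ^ k - 1) / ((q : ℝ) - 1)

/-- The `q`-factorial `[k]_q! = [1]_q [2]_q ⋯ [k]_q`. -/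
noncomputable def qFactorial (q k : ℕ) : ℝ :=
  ∏ j ∈ Finset.range k, qInteger q (j + 1)

/-- The `q`-binomial coefficient `[a choose m]_q` with an integer upper entry `a`:
it is `1` for `m = 0` (whatever `a` is, so `[-1 choose 0]_q = 1`), it is
`[a]_q! / ([m]_q! [a - m]_q!)` for `0 < m ≤ a`, and `0` otherwise. -/
noncomputable def qBinomial (q : ℕ) (a : ℤ) (m : ℕ) : ℝ :=
  if m = 0 then 1
  else if (m : ℤ) ≤ a then
    qFactorial q a.toNat / (qFactorial q m * qFactorial q (a - m).toNat)
  else 0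

open Classical in
/-- The inclusion matrix `M(n, q; r, c)` of the `r`-dimensional versus the `c`-dimensional
subspaces of `F ^ n`. -/
noncomputable def inclusionMatrix (F : Type*) [Field F] (n r c : ℕ) :
    Matrix (DimSubspace F n r) (DimSubspace F n c) ℝ :=
  Matrix.of fun R C => if R.1 ≤ C.1 then 1 else 0

/-- The `(C, R)`-entry of `M*` as a function of `i = dim (R ∩ C)`, where `N = max n (r + c)`.
It is only used for `i ≤ r ≤ c`, where no truncated subtraction of natural numbers occurs. -/
noncomputable def starEntry (q n r c i : ℕ) : ℝ :=
  (-1) ^ (r - i) *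
    (qBinomial q ((c : ℤ) - i - 1) (r - i) /
      (qBinomial q (((max n (r + c) : ℕ) : ℤ) - r) (c - r) *
        qBinomial q (((max n (r + c) : ℕ) : ℤ) - c) (r - i))) *
    (1 / (q : ℝ) ^ ((c - r) * (r - i) + (r - i).choose 2))

/-- The matrix `M*`, over a finite field with `q = Nat.card F` elements. -/
noncomputable def starMatrix (F : Type*) [Field F] (n r c : ℕ) :
    Matrix (DimSubspace F n c) (DimSubspace F n r) ℝ :=
  Matrix.of fun C R =>
    starEntry (Nat.card F) n r c (Module.finrank F (R.1 ⊓ C.1 : Submodule F (Fin n → F)))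

/-! ### Arithmetic of `q`-binomial coefficients -/

section QArithmetic

variable {q : ℕ}

/-! Each entry of `M M*` or `M* M` groups its summands by an intersection dimension, so it is a sum
of subspace counts times values of `starEntry`. By `meetCount_eq` the counts depend only on
dimensions, which makes both products symmetric. Moreover one product is the identity: `M M* = 1` if
`r + c ≤ n`, and `M* M = 1` if `n ≤ r + c`. Either one yields the two remaining Penrose equations.

Put `d = c - r`, let `t = r - i` be the intersection defect, and let `k` be the codimension of `R ∩
R'` in `R`, or of `C ∩ C'` in `C`. Both cases then become one identity, `∑ t, defectWeight q m k d t
= if k = 0 then 1 else 0`, where `m = N - r` equals `n - r` or `c`. For `k, d > 0` the weight is a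
constant times `(-1)^t [k choose t] q^(t choose 2)`, times `q^(-t(k-1))`, times `[d+t-1]! /
[d+t-k]!`. The last quotient is a polynomial of degree `k - 1` in `q^t`, so the sum vanishes by the
`q`-binomial theorem at `x = q^(-s)`, `0 ≤ s < k`. -/

theorem qInteger_pos (hq : 1 < q) (k : ℕ) : 0 < qInteger q (k + 1) := by
  have h : (1 : ℝ) < q := by exact_mod_cast hq
  have h2 : (1 : ℝ) < (q : ℝ) ^ (k + 1) := one_lt_pow₀ h (by omega)
  unfold qInteger
  exact div_pos (by linarith) (by linarith)

theorem qFactorial_succ (q k : ℕ) :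
    qFactorial q (k + 1) = qFactorial q k * qInteger q (k + 1) := by
  simp [qFactorial, Finset.prod_range_succ]

theorem qFactorial_zero (q : ℕ) : qFactorial q 0 = 1 := by
  simp [qFactorial]

theorem qFactorial_ne_zero (hq : 1 < q) (k : ℕ) : qFactorial q k ≠ 0 :=
  Finset.prod_ne_zero_iff.2 fun j _ => (qInteger_pos hq j).ne'

theorem qInteger_add (hq : 1 < q) (a b : ℕ) :
    qInteger q (a + b) = qInteger q a + (q : ℝ) ^ a * qInteger q b := by
  have h : (q : ℝ) - 1 ≠ 0 := sub_ne_zero.2 (by exact_mod_cast hq.ne')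
  unfold qInteger
  field_simp
  ring

theorem qBinomial_zero_right (q : ℕ) (a : ℤ) : qBinomial q a 0 = 1 := by
  simp [qBinomial]

theorem qBinomial_add_left (hq : 1 < q) (m e : ℕ) :
    qBinomial q ((m + e : ℕ) : ℤ) m = qFactorial q (m + e) / (qFactorial q m * qFactorial q e) := by
  have h := qFactorial_ne_zero hq
  rcases eq_or_ne m 0 with rfl | hm
  · simp [qBinomial, qFactorial_zero, h]
  · have h2 : (((m + e : ℕ) : ℤ) - m).toNat = e := by omega
    simp only [qBinomial, hm, if_false, h2, Int.toNat_natCast]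
    rw [if_pos (by omega)]

theorem qBinomial_of_lt {a m : ℕ} (h : a < m) : qBinomial q (a : ℤ) m = 0 := by
  unfold qBinomial
  rw [if_neg (by omega), if_neg (by omega)]

theorem qBinomial_ne_zero (hq : 1 < q) {a m : ℕ} (h : m ≤ a) : qBinomial q (a : ℤ) m ≠ 0 := by
  obtain ⟨e, rfl⟩ := Nat.exists_eq_add_of_le h
  have h := qFactorial_ne_zero hq
  rw [qBinomial_add_left hq]
  exact div_ne_zero (h _) (mul_ne_zero (h _) (h _))

/-- Absorption identity, which drives both induction steps of `meetCount_eq`. -/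
theorem qInteger_mul_qBinomial_succ (hq : 1 < q) (a m : ℕ) :
    qInteger q (m + 1) * qBinomial q ((a + 1 : ℕ) : ℤ) (m + 1) =
      qInteger q (a + 1) * qBinomial q (a : ℤ) m := by
  rcases lt_or_ge a m with h | h
  · rw [qBinomial_of_lt h, qBinomial_of_lt (by omega)]; simp
  · obtain ⟨e, rfl⟩ := Nat.exists_eq_add_of_le h
    have h := qFactorial_ne_zero hq
    have h1 := qInteger_pos hq m
    have := h m
    have := h e
    rw [qBinomial_add_left hq, show m + e + 1 = m + 1 + e by ring, qBinomial_add_left hq,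
      show m + 1 + e = m + e + 1 by ring, qFactorial_succ, qFactorial_succ]
    field_simp

theorem qBinomial_succ_succ (hq : 1 < q) (a m : ℕ) :
    qBinomial q ((a + 1 : ℕ) : ℤ) (m + 1) =
      qBinomial q (a : ℤ) m + (q : ℝ) ^ (m + 1) * qBinomial q (a : ℤ) (m + 1) := by
  have h := qFactorial_ne_zero hq
  rcases lt_trichotomy a m with hl | rfl | hl
  · rw [qBinomial_of_lt hl, qBinomial_of_lt (by omega), qBinomial_of_lt (by omega)]; simp
  · have h1 := qBinomial_add_left hq a 0
    have h2 := qBinomial_add_left hq (a + 1) 0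
    simp only [add_zero, qFactorial_zero, mul_one, div_self (h _)] at h1 h2
    rw [h1, h2, qBinomial_of_lt (by omega)]; simp
  · obtain ⟨e, rfl⟩ := Nat.exists_eq_add_of_le (Nat.succ_le_of_lt hl)
    have h1 := (qInteger_pos hq m).ne'
    have h2 := (qInteger_pos hq e).ne'
    have := h m
    have := h e
    have e1 := qBinomial_add_left hq (m + 1) (e + 1)
    have e2 := qBinomial_add_left hq (m + 1) e
    have e3 := qBinomial_add_left hq m (e + 1)
    have h3 := qInteger_add hq (m + 1) (e + 1)
    rw [show m + (e + 1) = m + 1 + e by ring] at e3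
    rw [← add_assoc] at e1 h3
    rw [Nat.succ_eq_add_one, e1, e2, e3, qFactorial_succ q (m + 1 + e), qFactorial_succ q m,
      qFactorial_succ q e, h3]
    field_simp

/-- The `q`-binomial theorem. -/
theorem sum_qBinomial_eq_prod (hq : 1 < q) (k : ℕ) (x : ℝ) :
    ∑ t ∈ Finset.range (k + 1), (-1) ^ t * qBinomial q (k : ℤ) t * (q : ℝ) ^ t.choose 2 * x ^ t =
      ∏ i ∈ Finset.range k, (1 - (q : ℝ) ^ i * x) := by
  induction k generalizing x with
  | zero => simp [qBinomial_zero_right]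
  | succ k ih =>
    have h1 : ∏ i ∈ Finset.range (k + 1), (1 - (q : ℝ) ^ i * x) =
        (1 - x) * ∏ i ∈ Finset.range k, (1 - (q : ℝ) ^ i * (q * x)) := by
      rw [Finset.prod_range_succ', mul_comm]
      simp [pow_succ, mul_assoc]
    rw [h1, ← ih, sub_mul, one_mul, Finset.sum_range_succ']
    simp only [qBinomial_succ_succ hq, mul_add, add_mul, Finset.sum_add_distrib]
    have h2 := Finset.sum_range_succ'
      (fun t => (-1) ^ t * qBinomial q (k : ℤ) t * (q : ℝ) ^ t.choose 2 * (q * x) ^ t) (k + 1)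
    rw [Finset.sum_range_succ, qBinomial_of_lt (Nat.lt_succ_self k)] at h2
    simp only [mul_zero, zero_mul, add_zero] at h2
    have h3 : ∀ t : ℕ, (-1 : ℝ) ^ (t + 1) * qBinomial q (k : ℤ) t * (q : ℝ) ^ (t + 1).choose 2 *
        x ^ (t + 1) =
        - (x * ((-1) ^ t * qBinomial q (k : ℤ) t * (q : ℝ) ^ t.choose 2 * (q * x) ^ t)) := by
      intro t
      rw [Nat.choose_succ_succ' t 1, Nat.choose_one_right, pow_add, mul_pow]
      ring
    have h4 : ∀ t : ℕ, (-1 : ℝ) ^ (t + 1) * ((q : ℝ) ^ (t + 1) * qBinomial q (k : ℤ) (t + 1)) *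
        (q : ℝ) ^ (t + 1).choose 2 * x ^ (t + 1) =
        (-1) ^ (t + 1) * qBinomial q (k : ℤ) (t + 1) * (q : ℝ) ^ (t + 1).choose 2 *
          (q * x) ^ (t + 1) := by
      intro t
      rw [mul_pow]; ring
    simp only [h3, h4, Finset.sum_neg_distrib, ← Finset.mul_sum]
    rw [h2]
    simp only [pow_zero, Nat.choose_zero_succ, qBinomial_zero_right]
    ring

/-- The `k`-th `q`-difference annihilates polynomials of degree less than `k`. -/
theorem sum_qBinomial_mul_eval_eq_zero (hq : 1 < q) (k : ℕ) (p : Polynomial ℝ)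
    (hp : p.natDegree ≤ k) :
    ∑ t ∈ Finset.range (k + 2), (-1) ^ t * qBinomial q ((k + 1 : ℕ) : ℤ) t *
      (q : ℝ) ^ t.choose 2 * (((q : ℝ) ^ (t * k))⁻¹ * p.eval ((q : ℝ) ^ t)) = 0 := by
  have h0 : (q : ℝ) ≠ 0 := by positivity
  simp only [Polynomial.eval_eq_sum_range' (Nat.lt_succ_of_le hp), Finset.mul_sum]
  rw [Finset.sum_comm]
  refine Finset.sum_eq_zero fun l hl => ?_
  have hl : l ≤ k := Nat.lt_succ_iff.1 (Finset.mem_range.1 hl)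
  -- The monomial `X ^ l` contributes the `q`-binomial sum at `x = q ^ (l - k)`, and there the
  -- factor with index `k - l` is zero.
  have h := sum_qBinomial_eq_prod hq (k + 1) ((q : ℝ) ^ l / (q : ℝ) ^ k)
  rw [Finset.prod_eq_zero (i := k - l) (Finset.mem_range.2 (by omega))] at h
  · rw [← mul_zero (p.coeff l), ← h, Finset.mul_sum]
    refine Finset.sum_congr rfl fun t _ => ?_
    rw [div_pow, ← pow_mul, ← pow_mul, ← pow_mul, mul_comm k t, mul_comm l t]
    field_simp
  · rw [← mul_div_assoc, ← pow_add, Nat.sub_add_cancel hl, div_self (by positivity), sub_self]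

/-! ### Evaluation of the defect sums -/

/-- Exhibits `[e+k]! / [e]!` as a polynomial in `q ^ (e + k)`; later `e + k = d + t`, which makes it
a polynomial in `q ^ t`. -/
theorem qFactorial_add (hq : 1 < q) (e k : ℕ) :
    qFactorial q (e + k) = qFactorial q e *
      ∏ a ∈ Finset.range k, (((q : ℝ) ^ (e + k) - (q : ℝ) ^ a) / ((q : ℝ) ^ a * (q - 1))) := by
  have h0 : (q : ℝ) ≠ 0 := by positivity
  have h1 : (q : ℝ) - 1 ≠ 0 := sub_ne_zero.2 (by exact_mod_cast hq.ne')
  induction k with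
  | zero => simp
  | succ k ih =>
    rw [← add_assoc, qFactorial_succ, ih, Finset.prod_range_succ', mul_assoc]
    congr 2
    · refine Finset.prod_congr rfl fun a _ => ?_
      rw [pow_succ, pow_succ, ← sub_mul, mul_right_comm, mul_div_mul_right _ _ h0]
    · simp [qInteger]

/-- The weight of intersection defect `t` in the products of the inclusion matrix with its
Moore-Penrose inverse. -/
noncomputable def defectWeight (q m k d t : ℕ) : ℝ :=
  if k ≤ d + t then
    (q : ℝ) ^ (t * (d + t - k)) * qBinomial q (k : ℤ) t *
      qBinomial q ((m - k : ℕ) : ℤ) (d + t - k) *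
      ((-1) ^ t * (qBinomial q ((d : ℤ) + t - 1) t /
        (qBinomial q (m : ℤ) d * qBinomial q ((m - d : ℕ) : ℤ) t)) *
        (1 / (q : ℝ) ^ (d * t + t.choose 2)))
  else 0

theorem sum_defectWeight_zero (hq : 1 < q) {m d : ℕ} (h : d ≤ m) :
    ∑ t ∈ Finset.range 1, defectWeight q m 0 d t = 1 := by
  have := qBinomial_ne_zero hq h
  simp [defectWeight, qBinomial_zero_right, this]

/-- Isolates the dependence on `t`: a constant, a `q`-difference coefficient and a polynomial of
degree `k` in `q ^ t`. -/
theorem defectWeight_eq (hq : 1 < q) {m k d t : ℕ} (h : k + 1 + (d + 1) ≤ m) (ht : t ≤ k + 1) :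
    defectWeight q m (k + 1) (d + 1) t =
      qFactorial q (m - (k + 1)) / (qFactorial q (m - (d + 1)) * qFactorial q d *
        qBinomial q (m : ℤ) (d + 1)) *
      ((-1) ^ t * qBinomial q ((k + 1 : ℕ) : ℤ) t * (q : ℝ) ^ t.choose 2 *
        (((q : ℝ) ^ (t * k))⁻¹ * ∏ a ∈ Finset.range k,
          (((q : ℝ) ^ d * (q : ℝ) ^ t - (q : ℝ) ^ a) / ((q : ℝ) ^ a * (q - 1))))) := by
  have h0 : (q : ℝ) ≠ 0 := by positivity
  unfold defectWeight
  split_ifs with hk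
  · obtain ⟨e, he⟩ := Nat.exists_eq_add_of_le hk
    obtain ⟨f, rfl⟩ : ∃ f, m = d + 1 + t + f := Nat.exists_eq_add_of_le (by omega)
    have he' : t + d = e + k := by omega
    have hd : ((d + 1 : ℕ) : ℤ) + t - 1 = ((t + d : ℕ) : ℤ) := by push_cast; ring
    have hf := qFactorial_ne_zero hq
    have h1 := hf d
    have h2 := hf e
    have h3 := hf f
    have h4 := hf t
    have h5 := hf (t + f)
    have h6 := qBinomial_ne_zero hq (show d + 1 ≤ d + 1 + t + f by omega)
    rw [hd, qBinomial_add_left hq, show d + 1 + t - (k + 1) = e by omega,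
      show d + 1 + t + f - (k + 1) = e + f by omega, show d + 1 + t + f - (d + 1) = t + f by omega,
      qBinomial_add_left hq, qBinomial_add_left hq, he', qFactorial_add hq e k, ← he']
    have hp : (q : ℝ) ^ (t * e) * (q : ℝ) ^ (t * k) =
        (q : ℝ) ^ ((d + 1) * t + t.choose 2) * (q : ℝ) ^ t.choose 2 := by
      rw [← pow_add, ← pow_add]
      congr 1
      have h7 : t * (t - 1) = 2 * t.choose 2 := by
        rw [Nat.choose_two_right, Nat.mul_div_cancel' (Nat.even_mul_pred_self t).two_dvd]
      rcases t with _ | t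
      · simp
      · simp only [Nat.add_sub_cancel] at h7
        have : e + k = d + (t + 1) := by omega
        rw [← mul_add, this, add_assoc, ← two_mul, ← h7]
        ring
    have hp' : (q : ℝ) ^ (t * e) / (q : ℝ) ^ ((d + 1) * t + t.choose 2) =
        (q : ℝ) ^ t.choose 2 * ((q : ℝ) ^ (t * k))⁻¹ := by
      rw [← div_eq_mul_inv, div_eq_div_iff (by positivity) (by positivity), hp, mul_comm]
    rw [show (q : ℝ) ^ (t + d) = (q : ℝ) ^ d * (q : ℝ) ^ t by rw [← pow_add, add_comm]]
    generalize (∏ a ∈ Finset.range k,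
          (((q : ℝ) ^ d * (q : ℝ) ^ t - (q : ℝ) ^ a) / ((q : ℝ) ^ a * (q - 1)))) = P
    calc _ = ((q : ℝ) ^ (t * e) / (q : ℝ) ^ ((d + 1) * t + t.choose 2)) *
          (qBinomial q ((k + 1 : ℕ) : ℤ) t *
          (qFactorial q (e + f) / (qFactorial q e * qFactorial q f)) * ((-1) ^ t *
          (qFactorial q e * P / (qFactorial q t * qFactorial q d) /
          (qBinomial q ((d + 1 + t + f : ℕ) : ℤ) (d + 1) *
            (qFactorial q (t + f) / (qFactorial q t * qFactorial q f)))))) := by ring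
      _ = _ := by
        rw [hp']
        field_simp
  -- Here `d + t < k`, and the polynomial vanishes by itself, so the cut-off in `defectWeight` costs
  -- nothing.
  · rw [Finset.prod_eq_zero (i := d + t) (Finset.mem_range.2 (by omega))]
    · simp
    · rw [pow_add, sub_self, zero_div]

theorem sum_defectWeight_succ (hq : 1 < q) {m k d : ℕ} (h : k + 1 + d ≤ m) :
    ∑ t ∈ Finset.range (k + 2), defectWeight q m (k + 1) d t = 0 := by
  rcases d with _ | d
  -- For `d = 0` each term is zero: the cut-off kills `t = 0`, and `[t-1 choose t] = 0` kills the
  -- others.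
  · refine Finset.sum_eq_zero fun t ht => ?_
    rcases t with _ | t
    · simp [defectWeight]
    · simp [defectWeight, qBinomial_of_lt (Nat.lt_succ_self t)]
  · rw [Finset.sum_congr rfl fun t ht => defectWeight_eq hq h
      (Nat.lt_succ_iff.1 (Finset.mem_range.1 ht)), ← Finset.mul_sum]
    let p : Polynomial ℝ := ∏ a ∈ Finset.range k,
      (Polynomial.C ((q : ℝ) ^ d) * Polynomial.X - Polynomial.C ((q : ℝ) ^ a)) *
        Polynomial.C ((q : ℝ) ^ a * (q - 1))⁻¹
    have hp : p.natDegree ≤ k := by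
      refine (Polynomial.natDegree_prod_le _ _).trans ?_
      refine (Finset.sum_le_card_nsmul _ _ 1 fun a _ => ?_).trans (by simp)
      compute_degree
    have := sum_qBinomial_mul_eval_eq_zero hq k p hp
    simp only [p, Polynomial.eval_prod, Polynomial.eval_mul, Polynomial.eval_sub,
      Polynomial.eval_C, Polynomial.eval_X, ← div_eq_mul_inv] at this
    rw [this, mul_zero]

end QArithmetic

theorem qBinomial_symm {q : ℕ} (hq : 1 < q) {a m : ℕ} (h : m ≤ a) :
    qBinomial q (a : ℤ) (a - m) = qBinomial q (a : ℤ) m := by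
  obtain ⟨e, rfl⟩ := Nat.exists_eq_add_of_le h
  rw [Nat.add_sub_cancel_left, qBinomial_add_left hq, add_comm m e, qBinomial_add_left hq,
    mul_comm]

/-! ### Counting subspaces by their intersection with a fixed subspace -/

section Counting

open Module

variable {F : Type*} [Field F]

/-- The number of `d`-dimensional subspaces meeting `K` in dimension `j`. -/
noncomputable def meetCount {V : Type*} [AddCommGroup V] [Module F V] (K : Submodule F V)
    (d j : ℕ) : ℕ :=
  Nat.card {W : Submodule F V // finrank F W = d ∧ finrank F (W ⊓ K : Submodule F V) = j}

/-- By the modular law, `W/U ∩ (K+U)/U` is the image of `W ∩ K`; the kernel of that projection is `K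
∩ U`. -/
theorem finrank_map_mkQ_inf {V : Type*} [AddCommGroup V] [Module F V] [FiniteDimensional F V]
    {U W : Submodule F V} (h : U ≤ W) (K : Submodule F V) :
    finrank F (W.map U.mkQ ⊓ K.map U.mkQ : Submodule F (V ⧸ U)) +
      finrank F (K ⊓ U : Submodule F V) = finrank F (W ⊓ K : Submodule F V) := by
  have h1 : W.map U.mkQ ⊓ K.map U.mkQ = (W ⊓ K).map U.mkQ := by
    apply Submodule.comap_injective_of_surjective U.mkQ_surjective
    rw [Submodule.comap_inf, Submodule.comap_map_mkQ, Submodule.comap_map_mkQ,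
      Submodule.comap_map_mkQ, sup_eq_right.2 h, inf_comm, inf_comm W, sup_inf_assoc_of_le _ h]
  have h2 := LinearMap.finrank_range_add_finrank_ker (U.mkQ.domRestrict (W ⊓ K))
  rw [LinearMap.range_domRestrict, LinearMap.ker_domRestrict, Submodule.ker_mkQ] at h2
  rw [h1, ← h2]
  congr 1
  have h3 : (U.comap (W ⊓ K).subtype).map (W ⊓ K).subtype = K ⊓ U := by
    rw [Submodule.map_comap_subtype]
    ext x
    simp only [Submodule.mem_inf]
    exact ⟨fun h => ⟨h.1.2, h.2⟩, fun hx => ⟨⟨h hx.2, hx.1⟩, hx.2⟩⟩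
  rw [← h3, Submodule.finrank_map_subtype_eq]

theorem finrank_map_mkQ {V : Type*} [AddCommGroup V] [Module F V] [FiniteDimensional F V]
    {U W : Submodule F V} (h : U ≤ W) :
    finrank F (W.map U.mkQ) + finrank F U = finrank F W := by
  have := finrank_map_mkQ_inf h W
  rwa [inf_idem, inf_idem, inf_eq_right.2 h] at this

/-- Subspaces above `U` correspond to subspaces of the quotient by `U`. -/
theorem card_subspaces_above {V : Type*} [AddCommGroup V] [Module F V] [FiniteDimensional F V]
    (U K : Submodule F V) (d j : ℕ) :
    Nat.card {W : Submodule F V // U ≤ W ∧ finrank F W = d + finrank F U ∧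
      finrank F (W ⊓ K : Submodule F V) = j + finrank F (K ⊓ U : Submodule F V)} =
    meetCount (K.map U.mkQ) d j := by
  refine Nat.card_congr
    { toFun := fun W => ⟨W.1.map U.mkQ, ?_, ?_⟩
      invFun := fun W => ⟨W.1.comap U.mkQ, ?_, ?_, ?_⟩
      left_inv := fun W => Subtype.ext ?_
      right_inv := fun W => Subtype.ext ?_ }
  · have := finrank_map_mkQ W.2.1
    have := W.2.2.1
    omega
  · have := finrank_map_mkQ_inf W.2.1 K
    have := W.2.2.2
    omega
  · exact Submodule.le_comap_mkQ U W.1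
  · have := finrank_map_mkQ (Submodule.le_comap_mkQ U W.1)
    rw [Submodule.map_comap_eq_of_surjective U.mkQ_surjective, W.2.1] at this
    exact this.symm
  · have := finrank_map_mkQ_inf (Submodule.le_comap_mkQ U W.1) K
    rw [Submodule.map_comap_eq_of_surjective U.mkQ_surjective, W.2.2] at this
    exact this.symm
  · simp only [Submodule.comap_map_mkQ, sup_eq_right.2 W.2.1]
  · exact Submodule.map_comap_eq_of_surjective U.mkQ_surjective W.1

/-- Subspaces below `X` correspond to subspaces of `X`. -/
theorem card_subspaces_below {V : Type*} [AddCommGroup V] [Module F V]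
    (X K : Submodule F V) (d j : ℕ) :
    Nat.card {W : Submodule F V // W ≤ X ∧ finrank F W = d ∧
      finrank F (W ⊓ K : Submodule F V) = j} = meetCount (K.comap X.subtype) d j := by
  have key : ∀ W : Submodule F X, finrank F (W ⊓ K.comap X.subtype : Submodule F X) =
      finrank F (W.map X.subtype ⊓ K : Submodule F V) := by
    intro W
    rw [← Submodule.finrank_map_subtype_eq X, Submodule.map_inf _ X.subtype_injective,
      Submodule.map_comap_subtype, ← inf_assoc, inf_eq_left.2 (Submodule.map_subtype_le X W)]
  refine Nat.card_congr
    { toFun := fun W => ⟨W.1.comap X.subtype, ?_, ?_⟩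
      invFun := fun W => ⟨W.1.map X.subtype, Submodule.map_subtype_le X W.1, ?_, ?_⟩
      left_inv := fun W => Subtype.ext ?_
      right_inv := fun W => Subtype.ext ?_ }
  · rw [← Submodule.finrank_map_subtype_eq X, Submodule.map_comap_subtype,
      inf_eq_right.2 W.2.1, W.2.2.1]
  · rw [key, Submodule.map_comap_subtype, inf_eq_right.2 W.2.1, W.2.2.2]
  · rw [Submodule.finrank_map_subtype_eq, W.2.1]
  · rw [← key, W.2.2]
  · simp only [Submodule.map_comap_subtype, inf_eq_right.2 W.2.1]
  · exact Submodule.comap_map_eq_of_injective X.subtype_injective W.1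

theorem meetCount_eq_zero {V : Type*} [AddCommGroup V] [Module F V] [FiniteDimensional F V]
    (K : Submodule F V) {d j : ℕ} (h : d < j ∨ finrank F K < j) : meetCount K d j = 0 := by
  rw [meetCount, Nat.card_eq_zero]
  refine Or.inl ⟨fun ⟨W, h1, h2⟩ => ?_⟩
  have := Submodule.finrank_mono (inf_le_left : W ⊓ K ≤ W)
  have := Submodule.finrank_mono (inf_le_right : W ⊓ K ≤ K)
  omega

variable [Finite F]

theorem card_mem_not_mem {V : Type*} [AddCommGroup V] [Module F V] [FiniteDimensional F V]
    (A B : Submodule F V) :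
    (Nat.card {v : V // v ∈ A ∧ v ∉ B} : ℝ) = (Nat.card F : ℝ) ^ finrank F A -
      (Nat.card F : ℝ) ^ finrank F (A ⊓ B : Submodule F V) := by
  have : Finite V := Module.finite_of_finite F
  have h1 : Nat.card A = Nat.card F ^ finrank F A := Module.natCard_eq_pow_finrank
  have h2 : Nat.card (A ⊓ B : Submodule F V) = Nat.card F ^ finrank F (A ⊓ B : Submodule F V) :=
    Module.natCard_eq_pow_finrank
  have h3 : Nat.card {v : V // v ∈ A ∧ v ∉ B} + Nat.card (A ⊓ B : Submodule F V) = Nat.card A := by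
    have h4 : ((A : Set V) ∩ B).ncard + ((A : Set V) \ B).ncard = (A : Set V).ncard :=
      Set.ncard_inter_add_ncard_sdiff_eq_ncard _ _
    rw [add_comm]
    exact h4
  rw [eq_sub_iff_add_eq]
  exact_mod_cast h1 ▸ h2 ▸ h3

/-- Double counting of incidences between subspaces `W` and vectors of `A` outside `B`. -/
theorem meetCount_mul_eq {V : Type*} [AddCommGroup V] [Module F V] [FiniteDimensional F V]
    (K A B : Submodule F V) (d j a b : ℕ) (y : ℝ)
    (ha : ∀ W : Submodule F V, finrank F W = d → finrank F (W ⊓ K : Submodule F V) = j →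
      finrank F (W ⊓ A : Submodule F V) = a ∧ finrank F (W ⊓ A ⊓ B : Submodule F V) = b)
    (hy : ∀ v ∈ A, v ∉ B → (Nat.card {W : Submodule F V // F ∙ v ≤ W ∧ finrank F W = d ∧
      finrank F (W ⊓ K : Submodule F V) = j} : ℝ) = y) :
    (meetCount K d j : ℝ) * ((Nat.card F : ℝ) ^ a - (Nat.card F : ℝ) ^ b) =
      ((Nat.card F : ℝ) ^ finrank F A - (Nat.card F : ℝ) ^ finrank F (A ⊓ B : Submodule F V)) *
        y := by
  classical
  have : Finite V := Module.finite_of_finite F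
  have := Fintype.ofFinite V
  have := Fintype.ofFinite (Submodule F V)
  let s : Finset (Submodule F V) := Finset.univ.filter fun W =>
    finrank F W = d ∧ finrank F (W ⊓ K : Submodule F V) = j
  let t : Finset V := Finset.univ.filter fun v => v ∈ A ∧ v ∉ B
  have hs : meetCount K d j = s.card := by
    rw [meetCount, Nat.card_eq_fintype_card, Fintype.card_subtype]
  have ht : Nat.card {v : V // v ∈ A ∧ v ∉ B} = t.card := by
    rw [Nat.card_eq_fintype_card, Fintype.card_subtype]
  have key := Finset.sum_card_bipartiteAbove_eq_sum_card_bipartiteBelow (s := s) (t := t)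
    (fun W v => v ∈ W)
  have key' := congrArg (Nat.cast (R := ℝ)) key
  push_cast at key'
  rw [Finset.sum_congr rfl (g := fun _ => (Nat.card F : ℝ) ^ a - (Nat.card F : ℝ) ^ b),
    Finset.sum_congr (s₁ := t) rfl (g := fun _ => y)] at key'
  · rw [Finset.sum_const, Finset.sum_const, nsmul_eq_mul, nsmul_eq_mul] at key'
    rw [← card_mem_not_mem, hs, key', ht]
  · intro v hv
    obtain ⟨hA, hB⟩ := (Finset.mem_filter.1 hv).2
    rw [← hy v hA hB, Nat.card_eq_fintype_card, Fintype.card_subtype, Finset.bipartiteBelow,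
      Finset.filter_filter]
    congr 2
    ext W
    simp only [Finset.mem_filter, Submodule.span_singleton_le_iff_mem]
    tauto
  · intro W hW
    obtain ⟨h1, h2⟩ := (Finset.mem_filter.1 hW).2
    obtain ⟨h3, h4⟩ := ha W h1 h2
    rw [← h3, ← h4, ← card_mem_not_mem, Nat.card_eq_fintype_card, Fintype.card_subtype,
      Finset.bipartiteAbove, Finset.filter_filter]
    congr 2
    ext v
    simp only [Finset.mem_filter, Submodule.mem_inf]
    tauto

/-- Induction on `d`, passing to the quotient by a line `⟨v⟩` contained in `W`. For `j = 0` the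
vectors `v` run outside `K`, otherwise over the nonzero vectors of `K`. -/
theorem meetCount_eq {V : Type*} [AddCommGroup V] [Module F V] [FiniteDimensional F V]
    (K : Submodule F V) (d j k l : ℕ) (hK : finrank F K = k) (hV : finrank F V = k + l)
    (hj : j ≤ d) :
    (meetCount K d j : ℝ) = (Nat.card F : ℝ) ^ ((k - j) * (d - j)) *
      qBinomial (Nat.card F) (k : ℤ) j * qBinomial (Nat.card F) (l : ℤ) (d - j) := by
  have hq : 1 < Nat.card F := Finite.one_lt_card
  set q := Nat.card F with hqdef
  have hq' : (1 : ℝ) < q := by exact_mod_cast hq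
  have hq1 : (q : ℝ) - 1 ≠ 0 := by linarith
  have hqi : ∀ i : ℕ, (q : ℝ) ^ i - 1 = qInteger q i * (q - 1) := fun i => by
    rw [qInteger, div_mul_cancel₀ _ hq1]
  induction d generalizing V j k l with
  | zero =>
    obtain rfl : j = 0 := by omega
    have : meetCount K 0 0 = 1 := by
      rw [meetCount, Nat.card_eq_one_iff_unique]
      refine ⟨⟨fun W W' => Subtype.ext ?_⟩, ⟨⊥, by simp, by simp⟩⟩
      rw [Submodule.finrank_eq_zero.1 W.2.1, Submodule.finrank_eq_zero.1 W'.2.1]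
    simp [this, qBinomial_zero_right]
  | succ d ih =>
    rcases j with _ | j
    -- The quotient keeps `k` and lowers `l`. If `l = 0` there is no such `v`, so the truncated `l -
    -- 1` is harmless.
    · have h := meetCount_mul_eq K ⊤ K (d + 1) 0 (d + 1) 0
        ((q : ℝ) ^ (k * d) * qBinomial q ((l - 1 : ℕ) : ℤ) d)
        (fun W h1 h2 => by rw [inf_top_eq]; exact ⟨h1, h2⟩)
        (fun v _ hv => by
          have hv0 : v ≠ 0 := fun h => hv (h ▸ K.zero_mem)
          have h1 : finrank F (F ∙ v) = 1 := finrank_span_singleton hv0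
          have h2 : K ⊓ F ∙ v = ⊥ := by
            refine disjoint_iff.1 (Submodule.disjoint_span_singleton_of_notMem hv)
          have h3 := card_subspaces_above (F ∙ v) K d 0
          rw [h1, h2, finrank_bot] at h3
          rw [h3]
          have h4 := finrank_map_mkQ_inf (U := F ∙ v) (W := ⊤) le_top K
          rw [Submodule.map_top, Submodule.range_mkQ, top_inf_eq, top_inf_eq, h2, finrank_bot,
            hK] at h4
          have h5 := (F ∙ v).finrank_quotient_add_finrank
          rw [h1, hV] at h5
          have h6 := Submodule.finrank_le (K.map (F ∙ v).mkQ)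
          rw [ih _ 0 k (l - 1) h4 (by omega) (by omega)]
          simp [qBinomial_zero_right])
      rw [finrank_top, top_inf_eq, hK, hV] at h
      have h0 : (q : ℝ) ^ (d + 1) - 1 ≠ 0 := by
        rw [hqi]; exact mul_ne_zero (qInteger_pos hq d).ne' hq1
      rw [← mul_left_inj' h0, ← pow_zero (q : ℝ), h]
      simp only [Nat.sub_zero, qBinomial_zero_right, mul_one]
      rcases l with _ | l
      · rw [qBinomial_of_lt (Nat.succ_pos d)]; simp
      · have h1 := qInteger_mul_qBinomial_succ hq l d
        rw [pow_zero, hqi, pow_add, ← mul_sub_one, hqi, Nat.add_sub_cancel, mul_add, pow_add,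
          mul_one]
        linear_combination (-(q : ℝ) ^ (k * d) * q ^ k * (q - 1)) * h1
    -- Now the quotient lowers `k` and `j` and keeps `l`.
    · have h := meetCount_mul_eq K K ⊥ (d + 1) (j + 1) (j + 1) 0
        ((q : ℝ) ^ ((k - (j + 1)) * (d - j)) * qBinomial q ((k - 1 : ℕ) : ℤ) j *
          qBinomial q (l : ℤ) (d - j)) (fun W h1 h2 => by simp [h2])
        (fun v hv hv0 => by
          have hv0 : v ≠ 0 := fun h => hv0 (h ▸ Submodule.zero_mem _)
          have h1 : finrank F (F ∙ v) = 1 := finrank_span_singleton hv0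
          have h2 : K ⊓ F ∙ v = F ∙ v := by
            rw [inf_eq_right, Submodule.span_singleton_le_iff_mem]; exact hv
          have h3 := card_subspaces_above (F ∙ v) K d j
          rw [h2, h1] at h3
          rw [h3]
          have h4 := finrank_map_mkQ_inf (U := F ∙ v) (W := ⊤) le_top K
          rw [Submodule.map_top, Submodule.range_mkQ, top_inf_eq, top_inf_eq, h2, h1, hK] at h4
          have h5 := (F ∙ v).finrank_quotient_add_finrank
          rw [h1, hV] at h5
          rw [ih _ j (k - 1) l (by omega) (by omega) (by omega),
            show k - 1 - j = k - (j + 1) by omega])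
      rw [inf_bot_eq, finrank_bot, hK] at h
      have h0 : (q : ℝ) ^ (j + 1) - 1 ≠ 0 := by
        rw [hqi]; exact mul_ne_zero (qInteger_pos hq j).ne' hq1
      rw [← mul_left_inj' h0, ← pow_zero (q : ℝ), h]
      rcases k with _ | k
      · rw [qBinomial_of_lt (Nat.succ_pos j)]; simp
      · have h1 := qInteger_mul_qBinomial_succ hq k j
        rw [pow_zero, hqi, hqi, Nat.add_sub_cancel, Nat.add_sub_add_right d]
        linear_combination (-(q : ℝ) ^ ((k + 1 - (j + 1)) * (d - j)) *
          qBinomial q (l : ℤ) (d - j) * (q - 1)) * h1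

theorem meetCount_congr {V V' : Type*} [AddCommGroup V] [Module F V] [FiniteDimensional F V]
    [AddCommGroup V'] [Module F V'] [FiniteDimensional F V'] {K : Submodule F V}
    {K' : Submodule F V'} (hV : finrank F V = finrank F V') (hK : finrank F K = finrank F K')
    (d j : ℕ) : meetCount K d j = meetCount K' d j := by
  rcases lt_or_ge d j with h | h
  · rw [meetCount_eq_zero K (.inl h), meetCount_eq_zero K' (.inl h)]
  · obtain ⟨l, hl⟩ := Nat.exists_eq_add_of_le K.finrank_le
    have h1 := meetCount_eq K d j _ l rfl hl h
    have h2 := meetCount_eq K' d j _ l hK.symm (hV ▸ hl) h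
    exact_mod_cast h1.trans h2.symm

end Counting

/-! ### The products of the inclusion matrix with its Moore-Penrose inverse -/

section Products

open Module

/-- The shift `s` allows for `R' ∩ R`, which lies in every `R' ∩ C` with `R ≤ C` and disappears in
the quotient by `R`. -/
theorem sum_ite_mul_eq_sum_card {α : Type*} [Fintype α] (p : α → Prop) [DecidablePred p]
    (g : α → ℕ) (s b : ℕ) (hg : ∀ a, p a → s ≤ g a ∧ g a < b + s) (φ : ℕ → ℝ) :
    ∑ a, (if p a then 1 else 0) * φ (g a) =
      ∑ j ∈ Finset.range b, (Nat.card {a // p a ∧ g a = j + s} : ℝ) * φ (j + s) := by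
  classical
  have h1 : ∑ a, (if p a then 1 else 0) * φ (g a) =
      ∑ a ∈ Finset.univ.filter p, φ (g a) := by
    simp [Finset.sum_filter]
  rw [h1, ← Finset.sum_fiberwise_of_maps_to (t := Finset.range b) (g := fun a => g a - s)]
  · refine Finset.sum_congr rfl fun j _ => ?_
    rw [Nat.card_eq_fintype_card, Fintype.card_subtype, Finset.filter_filter, ← nsmul_eq_mul,
      ← Finset.sum_const]
    refine Finset.sum_congr ?_ ?_
    · ext a
      simp only [Finset.mem_filter, Finset.mem_univ, true_and, and_congr_right_iff]
      intro ha
      have := hg a ha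
      omega
    · intro a ha
      rw [(Finset.mem_filter.1 ha).2.2]
  · intro a ha
    have := hg a (Finset.mem_filter.1 ha).2
    rw [Finset.mem_range]
    omega

variable {F : Type*} [Field F]

theorem finrank_comap_subtype {V : Type*} [AddCommGroup V] [Module F V] (X Y : Submodule F V) :
    finrank F (Y.comap X.subtype) = finrank F (X ⊓ Y : Submodule F V) := by
  rw [← Submodule.finrank_map_subtype_eq X, Submodule.map_comap_subtype]

variable [Finite F]

theorem inclusionMatrix_mul_starMatrix_apply {n r c : ℕ} (hrc : r ≤ c) (R R' : DimSubspace F n r) :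
    (inclusionMatrix F n r c * starMatrix F n r c) R R' =
      ∑ j ∈ Finset.range (finrank F (R'.1.map R.1.mkQ) + 1),
        (meetCount (R'.1.map R.1.mkQ) (c - r) j : ℝ) *
          starEntry (Nat.card F) n r c (j + finrank F (R'.1 ⊓ R.1 : Submodule F (Fin n → F))) := by
  classical
  have h1 : finrank F (R'.1.map R.1.mkQ) + finrank F (R'.1 ⊓ R.1 : Submodule F (Fin n → F)) =
      r := by
    have := finrank_map_mkQ_inf (U := R.1) (W := ⊤) le_top R'.1
    rwa [Submodule.map_top, Submodule.range_mkQ, top_inf_eq, top_inf_eq, R'.2] at this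
  simp only [Matrix.mul_apply, inclusionMatrix, starMatrix, Matrix.of_apply]
  rw [sum_ite_mul_eq_sum_card _ (fun C : DimSubspace F n c =>
    finrank F (R'.1 ⊓ C.1 : Submodule F (Fin n → F))) _ _ ?_ (starEntry (Nat.card F) n r c)]
  · refine Finset.sum_congr rfl fun j _ => ?_
    rw [← card_subspaces_above]
    congr 2
    refine Nat.card_congr
      { toFun := fun C => ⟨C.1.1, C.2.1, ?_, ?_⟩
        invFun := fun C => ⟨⟨C.1, ?_⟩, C.2.1, ?_⟩
        left_inv := fun _ => rfl
        right_inv := fun _ => rfl }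
    · rw [C.1.2, R.2]; omega
    · rw [inf_comm]; exact C.2.2
    · rw [C.2.2.1, R.2]; omega
    · rw [inf_comm]; exact C.2.2.2
  · intro C hC
    refine ⟨Submodule.finrank_mono (inf_le_inf_left _ hC), ?_⟩
    have := Submodule.finrank_mono (inf_le_left : R'.1 ⊓ C.1 ≤ R'.1)
    rw [R'.2] at this
    omega

theorem starMatrix_mul_inclusionMatrix_apply {n r c : ℕ} (C C' : DimSubspace F n c) :
    (starMatrix F n r c * inclusionMatrix F n r c) C C' =
      ∑ j ∈ Finset.range (r + 1), (meetCount (C.1.comap C'.1.subtype) r j : ℝ) *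
          starEntry (Nat.card F) n r c j := by
  classical
  simp only [Matrix.mul_apply, inclusionMatrix, starMatrix, Matrix.of_apply]
  simp only [mul_comm (starEntry _ _ _ _ _)]
  rw [sum_ite_mul_eq_sum_card _ (fun R : DimSubspace F n r =>
    finrank F (R.1 ⊓ C.1 : Submodule F (Fin n → F))) 0 (r + 1) ?_
    (starEntry (Nat.card F) n r c)]
  · refine Finset.sum_congr rfl fun j _ => ?_
    rw [← card_subspaces_below, add_zero]
    congr 2
    exact Nat.card_congr
      { toFun := fun R => ⟨R.1.1, R.2.1, R.1.2, R.2.2⟩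
        invFun := fun R => ⟨⟨R.1, R.2.2.1⟩, R.2.1, R.2.2.2⟩
        left_inv := fun _ => rfl
        right_inv := fun _ => rfl }
  · intro R _
    have := Submodule.finrank_mono (inf_le_left : R.1 ⊓ C.1 ≤ R.1)
    rw [R.2] at this
    omega

theorem inclusionMatrix_mul_starMatrix_transpose {n r c : ℕ} (hrc : r ≤ c) :
    (inclusionMatrix F n r c * starMatrix F n r c).transpose =
      inclusionMatrix F n r c * starMatrix F n r c := by
  ext R R'
  rw [Matrix.transpose_apply, inclusionMatrix_mul_starMatrix_apply hrc,
    inclusionMatrix_mul_starMatrix_apply hrc, inf_comm]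
  have h1 := finrank_map_mkQ_inf (U := R.1) (W := ⊤) le_top R'.1
  have h2 := finrank_map_mkQ_inf (U := R'.1) (W := ⊤) le_top R.1
  rw [Submodule.map_top, Submodule.range_mkQ, top_inf_eq, top_inf_eq, R'.2] at h1
  rw [Submodule.map_top, Submodule.range_mkQ, top_inf_eq, top_inf_eq, R.2, inf_comm] at h2
  have h3 := R.1.finrank_quotient_add_finrank
  have h4 := R'.1.finrank_quotient_add_finrank
  have h5 := R.2
  have h6 := R'.2
  have h7 : finrank F (R.1.map R'.1.mkQ) = finrank F (R'.1.map R.1.mkQ) := by omega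
  rw [h7]
  refine Finset.sum_congr rfl fun j _ => ?_
  rw [meetCount_congr (by omega) h7]

theorem starMatrix_mul_inclusionMatrix_transpose (n r c : ℕ) :
    (starMatrix F n r c * inclusionMatrix F n r c).transpose =
      starMatrix F n r c * inclusionMatrix F n r c := by
  ext C C'
  rw [Matrix.transpose_apply, starMatrix_mul_inclusionMatrix_apply,
    starMatrix_mul_inclusionMatrix_apply]
  refine Finset.sum_congr rfl fun j _ => ?_
  rw [meetCount_congr (C.2.trans C'.2.symm)]
  rw [finrank_comap_subtype, finrank_comap_subtype, inf_comm]

theorem sum_defectWeight {q m k d : ℕ} (hq : 1 < q) (h : k + d ≤ m) :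
    ∑ t ∈ Finset.range (k + 1), defectWeight q m k d t = if k = 0 then 1 else 0 := by
  rcases k with _ | k
  · exact sum_defectWeight_zero hq (by omega)
  · exact sum_defectWeight_succ hq h

theorem inclusionMatrix_mul_starMatrix {n r c : ℕ} (hrc : r ≤ c) (hn : r + c ≤ n) :
    inclusionMatrix F n r c * starMatrix F n r c = 1 := by
  classical
  have hq : 1 < Nat.card F := Finite.one_lt_card
  ext R R'
  rw [inclusionMatrix_mul_starMatrix_apply hrc]
  have h1 := finrank_map_mkQ_inf (U := R.1) (W := ⊤) le_top R'.1
  rw [Submodule.map_top, Submodule.range_mkQ, top_inf_eq, top_inf_eq, R'.2] at h1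
  have h3 := R.1.finrank_quotient_add_finrank
  rw [R.2, finrank_fin_fun] at h3
  set K := R'.1.map R.1.mkQ
  set s := finrank F (R'.1 ⊓ R.1 : Submodule F (Fin n → F))
  obtain ⟨k, hk⟩ : ∃ k, finrank F K = k := ⟨_, rfl⟩
  have h0 : k = 0 ↔ R = R' := by
    rw [← hk, Submodule.finrank_eq_zero, ← le_bot_iff, Submodule.map_le_iff_le_comap,
      Submodule.comap_bot, Submodule.ker_mkQ]
    refine ⟨fun h => Subtype.ext ?_, fun h => h ▸ le_rfl⟩
    exact (Submodule.eq_of_le_of_finrank_eq h (R'.2.trans R.2.symm)).symm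
  -- `r + c ≤ n` supplies the bound for `sum_defectWeight`. Reflection substitutes the defect `t = k
  -- - j`.
  rw [Matrix.one_apply, ← if_congr h0 rfl rfl,
    ← sum_defectWeight hq (show k + (c - r) ≤ n - r by omega), hk,
    ← Finset.sum_range_reflect (defectWeight _ _ _ _)]
  refine Finset.sum_congr rfl fun j hj => ?_
  have hj : j ≤ k := Nat.lt_succ_iff.1 (Finset.mem_range.1 hj)
  rw [show k + 1 - 1 - j = k - j by omega, defectWeight]
  split_ifs with hd
  · have hd : j ≤ c - r := by omega
    rw [meetCount_eq K (c - r) j k (n - r - k) hk (by omega) hd, starEntry, max_eq_left hn,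
      show c - r + (k - j) - k = c - r - j by omega, show r - (j + s) = k - j by omega,
      qBinomial_symm hq hj]
    have e1 : (c : ℤ) - ((j + s : ℕ) : ℤ) - 1 = ((c - r : ℕ) : ℤ) + ((k - j : ℕ) : ℤ) - 1 := by
      omega
    have e2 : (n : ℤ) - r = ((n - r : ℕ) : ℤ) := by omega
    have e3 : (n : ℤ) - c = ((n - r - (c - r) : ℕ) : ℤ) := by omega
    rw [e1, e2, e3]
  -- Outside the cut-off `j > c - r`, so nothing is counted.
  · rw [meetCount_eq_zero K (.inl (by omega))]; simp

theorem starMatrix_mul_inclusionMatrix {n r c : ℕ} (hrc : r ≤ c) (hn : n ≤ r + c) :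
    starMatrix F n r c * inclusionMatrix F n r c = 1 := by
  classical
  have hq : 1 < Nat.card F := Finite.one_lt_card
  ext C C'
  rw [starMatrix_mul_inclusionMatrix_apply]
  have h1 := finrank_comap_subtype C'.1 C.1
  have h2 := Submodule.finrank_sup_add_finrank_inf_eq C'.1 C.1
  have h3 := (C'.1 ⊔ C.1).finrank_le
  have h4 := (C.1.comap C'.1.subtype).finrank_le
  rw [finrank_fin_fun] at h3
  rw [C.2, C'.2, ← h1] at h2
  rw [C'.2] at h4
  set K := C.1.comap C'.1.subtype
  obtain ⟨k, hk⟩ := Nat.exists_eq_add_of_le h4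
  have h0 : k = 0 ↔ C = C' := by
    refine ⟨fun h => Subtype.ext ?_, ?_⟩
    · have h5 : C'.1 ⊓ C.1 = C'.1 :=
        Submodule.eq_of_le_of_finrank_eq inf_le_left (by rw [← h1, C'.2]; omega)
      exact (Submodule.eq_of_le_of_finrank_eq (inf_eq_left.1 h5) (C'.2.trans C.2.symm)).symm
    · rintro rfl
      rw [inf_idem, C.2] at h1
      omega
  -- Since `k = dim (C + C') - c ≤ n - c ≤ r`, the bound for `sum_defectWeight` holds, and the sum
  -- extends from `t ≤ k` to `t ≤ r` by zero terms.
  rw [Matrix.one_apply, ← if_congr h0 rfl rfl,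
    ← sum_defectWeight hq (show k + (c - r) ≤ c by omega),
    Finset.sum_subset (Finset.range_subset_range.2 (show k + 1 ≤ r + 1 by omega)),
    ← Finset.sum_range_reflect (defectWeight _ _ _ _)]
  · refine Finset.sum_congr rfl fun i hi => ?_
    have hi : i ≤ r := Nat.lt_succ_iff.1 (Finset.mem_range.1 hi)
    rw [show r + 1 - 1 - i = r - i by omega, defectWeight]
    split_ifs with hd
    · have hd : i ≤ finrank F K := by omega
      rw [meetCount_eq K r i _ k rfl (C'.2.trans hk) hi, starEntry, max_eq_right hn,
        show c - r + (r - i) - k = finrank F K - i by omega,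
        show c - k = finrank F K by omega, qBinomial_symm hq hd]
      have e1 : (c : ℤ) - i - 1 = ((c - r : ℕ) : ℤ) + ((r - i : ℕ) : ℤ) - 1 := by omega
      have e2 : ((r + c : ℕ) : ℤ) - r = (c : ℤ) := by push_cast; ring
      have e3 : ((r + c : ℕ) : ℤ) - c = ((c - (c - r) : ℕ) : ℤ) := by omega
      rw [e1, e2, e3, mul_comm (r - i) (finrank F K - i)]
      ring
    · rw [meetCount_eq_zero K (.inr (by omega))]; simp
  · intro t _ ht
    rw [Finset.mem_range, not_lt] at ht
    simp [defectWeight, qBinomial_of_lt (show k < t by omega)]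

end Products

/-! ### Uniqueness and conclusion -/

/-- Penrose's argument: transposing `A G = (A H)(A G)` gives `A G = A H`, dually `G A = H A`, whence
`G = G A G = H A H = H`. -/
theorem IsMoorePenroseInverse.eq {K m n : Type*} [CommRing K] [Fintype m] [Fintype n]
    {A : Matrix m n K} {G H : Matrix n m K} (hG : IsMoorePenroseInverse A G)
    (hH : IsMoorePenroseInverse A H) : G = H := by
  have h1 : A * G = A * H := by
    calc A * G = (A * G).transpose := hG.transpose_left.symm
      _ = ((A * H) * (A * G)).transpose := by
        rw [← Matrix.mul_assoc, hH.mul_mul_left]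
      _ = (A * G) * (A * H) := by
        rw [Matrix.transpose_mul, hG.transpose_left, hH.transpose_left]
      _ = A * H := by rw [← Matrix.mul_assoc, hG.mul_mul_left]
  have h2 : G * A = H * A := by
    calc G * A = (G * A).transpose := hG.transpose_right.symm
      _ = ((G * A) * (H * A)).transpose := by
        rw [Matrix.mul_assoc, ← Matrix.mul_assoc A, hH.mul_mul_left]
      _ = (H * A) * (G * A) := by
        rw [Matrix.transpose_mul, hG.transpose_right, hH.transpose_right]
      _ = H * A := by rw [Matrix.mul_assoc, ← Matrix.mul_assoc A, hG.mul_mul_left]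
  rw [← hG.mul_mul_right, h2, Matrix.mul_assoc, h1, ← Matrix.mul_assoc, hH.mul_mul_right]

theorem isMoorePenroseInverse_starMatrix (F : Type*) [Field F] [Finite F] {n r c : ℕ}
    (hrc : r ≤ c) : IsMoorePenroseInverse (inclusionMatrix F n r c) (starMatrix F n r c) where
  transpose_left := inclusionMatrix_mul_starMatrix_transpose hrc
  transpose_right := starMatrix_mul_inclusionMatrix_transpose n r c
  mul_mul_left := by
    rcases le_total (r + c) n with h | h
    · rw [inclusionMatrix_mul_starMatrix hrc h, Matrix.one_mul]
    · rw [Matrix.mul_assoc, starMatrix_mul_inclusionMatrix hrc h, Matrix.mul_one]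
  mul_mul_right := by
    rcases le_total (r + c) n with h | h
    · rw [Matrix.mul_assoc, inclusionMatrix_mul_starMatrix hrc h, Matrix.mul_one]
    · rw [starMatrix_mul_inclusionMatrix hrc h, Matrix.one_mul]

theorem theorem3p6 (F : Type*) [Field F] [Finite F] (n r c : ℕ) (hrc : r ≤ c) (hcn : c ≤ n) :
    IsMoorePenroseInverse (inclusionMatrix F n r c) (starMatrix F n r c) ∧
      ∀ G : Matrix (DimSubspace F n c) (DimSubspace F n r) ℝ,
        IsMoorePenroseInverse (inclusionMatrix F n r c) G → G = starMatrix F n r c :=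
  ⟨isMoorePenroseInverse_starMatrix F hrc, fun _ hG =>
    hG.eq (isMoorePenroseInverse_starMatrix F hrc)⟩
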